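/- Let $\mathfrak{sl}_2$ be the Lie algebra of traceless complex $2\times 2$ matrices with standard generators $e,f,h$, where $[e,f]=h$, $[h,e]=2e$, $[h,f]=-2f$. For $a\in\mathbb{C}$ let $M_a$ be the Verma module with basis $f^jv_a$ ($j\ge 0$) and action $$e\,f^jv_a=j(a-j+1)f^{j-1}v_a,\qquad f\,f^jv_a=f^{j+1}v_a,\qquad h\,f^jv_a=(a-2j)f^jv_a,$$ and for a nonnegative integer $p$ let $L_p$ be the irreducible module of highest weight $p$ and dimension $p+1$. For an $\mathfrak{sl}_2$-module $V$ and $\mu\in\mathbb{C}$ let $V[\mu]=\{x\in V: hx=\mu x\}$. **Theorem 3.1.** Let $n\ge 1$, let $m_1,\dots,m_n$ and $k$ be nonnegative integers, and put $|m|=m_1+\cdots+m_n$, $M^{\otimes m}=M_{m_1}\otimes\cdots\otimes M_{m_n}$ and $L^{\otimes m}=L_{m_1}\otimes\cdots\otimes L_{m_n}$. For $j\in\mathbb{Z}$ let $w(m,j)$ be the multiplicity of $L_{|m|-2j}$ in $L^{\otimes m}$, with $w(m,j)=0$ if $|m|-2j<0$. Let $$f:(M^{\otimes m}[|m|-2k+2])^*\longrightarrow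 (M^{\otimes m}[|m|-2k])^*$$ be given by the contragredient action of $f\in\mathfrak{sl}_2$ on the restricted dual $\bigoplus_{\mu}(M^{\otimes m}[\mu])^*$, that is, $(f\varphi)(x)=\varphi(ex)$ for $x\in M^{\otimes m}[|m|-2k]$. 1. If $0\le |m|-k+1<k$, then $\dim\ker f=w(m,|m|-k+1)$ and $\dim\operatorname{coker} f=w(m,|m|-k+1)+\binom{n+k-2}{k}$. 2. Otherwise, $\ker f=0$ and $\dim\operatorname{coker} f=\binom{n+k-2}{k}$. Here $\binom{r}{0}=1$ for every integer $r$. -/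

import Mathlib

open scoped TensorProduct

namespace SlTwo

noncomputable section

attribute [local instance] LieRing.ofAssociativeRing

/-- The Lie algebra of traceless complex `2 × 2` matrices. -/
abbrev sl2 : Type := LieAlgebra.SpecialLinear.sl (Fin 2) ℂ

/-- The standard generator `e` of `sl2`. -/
def e : sl2 := ⟨!![0, 1; 0, 0], by simp [LieAlgebra.SpecialLinear.sl, Matrix.trace_fin_two]⟩

/-- The standard generator `f` of `sl2`. -/
def f : sl2 := ⟨!![0, 0; 1, 0], by simp [LieAlgebra.SpecialLinear.sl, Matrix.trace_fin_two]⟩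

/-- The standard generator `h` of `sl2`. -/
def h : sl2 := ⟨!![1, 0; 0, -1], by simp [LieAlgebra.SpecialLinear.sl, Matrix.trace_fin_two]⟩

theorem lie_e_f : ⁅e, f⁆ = h := by
  apply Subtype.ext
  rw [LieAlgebra.SpecialLinear.sl_bracket]
  ext i j
  fin_cases i <;> fin_cases j <;> simp [e, f, h]

theorem lie_h_e : ⁅h, e⁆ = (2 : ℂ) • e := by
  apply Subtype.ext
  rw [LieAlgebra.SpecialLinear.sl_bracket]
  ext i j
  fin_cases i <;> fin_cases j <;> norm_num [e, h]

theorem lie_h_f : ⁅h, f⁆ = (-2 : ℂ) • f := by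
  apply Subtype.ext
  rw [LieAlgebra.SpecialLinear.sl_bracket]
  ext i j
  fin_cases i <;> fin_cases j <;> norm_num [f, h]

/-- A representation of `sl2` on the complex vector space `V` (that is, an `sl2`-module). -/
abbrev Rep (V : Type) [AddCommGroup V] [Module ℂ V] : Type := sl2 →ₗ⁅ℂ⁆ Module.End ℂ V

section construction

variable {V : Type} [AddCommGroup V] [Module ℂ V]

/-- The representation in which `e`, `f`, `h` act by given operators `E`, `F`, `H` that satisfy
`[E, F] = H`, `[H, E] = 2 E`, `[H, F] = -2 F`. -/
def repOfTriple (E F H : Module.End ℂ V) (hEF : E * F - F * E = H)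
    (hHE : H * E - E * H = (2 : ℂ) • E) (hHF : H * F - F * H = (-2 : ℂ) • F) : Rep V where
  toFun A := A.1 0 1 • E + A.1 1 0 • F + A.1 0 0 • H
  map_add' A B := by
    change (A.1 0 1 + B.1 0 1) • E + (A.1 1 0 + B.1 1 0) • F + (A.1 0 0 + B.1 0 0) • H = _
    module
  map_smul' c A := by
    change (c * A.1 0 1) • E + (c * A.1 1 0) • F + (c * A.1 0 0) • H = c • _
    module
  map_lie' := by
    intro A B
    have hA : A.1 1 1 = - A.1 0 0 := by
      have h0 : Matrix.trace A.1 = 0 := A.2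
      rw [Matrix.trace_fin_two] at h0
      linear_combination h0
    have hB : B.1 1 1 = - B.1 0 0 := by
      have h0 : Matrix.trace B.1 = 0 := B.2
      rw [Matrix.trace_fin_two] at h0
      linear_combination h0
    have h1 : E * F = F * E + H := by rw [← hEF]; abel
    have h2 : H * E = E * H + (2 : ℂ) • E := by rw [← hHE]; abel
    have h3 : H * F = F * H + (-2 : ℂ) • F := by rw [← hHF]; abel
    simp only [LieAlgebra.SpecialLinear.sl_bracket, LieRing.of_associative_ring_bracket,
      Matrix.sub_apply, Matrix.mul_apply, Fin.sum_univ_two, hA, hB, mul_add, add_mul,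
      smul_mul_assoc, mul_smul_comm, h1, h2, h3]
    module

/-- The weight subspace `V[μ] = {x ∈ V | h x = μ x}`. -/
def weightSpace (ρ : Rep V) (μ : ℂ) : Submodule ℂ V := Module.End.eigenspace (ρ h) μ

theorem e_mem_weightSpace (ρ : Rep V) (μ : ℂ) :
    ∀ x ∈ weightSpace ρ μ, ρ e x ∈ weightSpace ρ (μ + 2) := by
  intro x hx
  rw [weightSpace, Module.End.mem_eigenspace_iff] at hx ⊢
  have := congrArg (fun T : Module.End ℂ V => T x) (LieHom.map_lie ρ h e)
  simp only [lie_h_e, map_smul, LieRing.of_associative_ring_bracket, LinearMap.sub_apply,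
    Module.End.mul_apply, LinearMap.smul_apply, hx] at this
  rw [add_smul, this]
  abel

/-- The raising map `e : V[μ] → V[μ + 2]`. -/
def raise (ρ : Rep V) (μ : ℂ) : weightSpace ρ μ →ₗ[ℂ] weightSpace ρ (μ + 2) :=
  (ρ e).restrict (e_mem_weightSpace ρ μ)

/-- The action of `f` on the restricted dual `⨁ μ, (V[μ])^*`, on the summand of weight `μ + 2`:
the map `f : (V[μ + 2])^* → (V[μ])^*`. In the contragredient action (the one twisted by the
anti-involution of `sl2` that exchanges `e` and `f` and fixes `h`) it is `(f φ)(x) = φ(e x)`. -/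
def dualLower (ρ : Rep V) (μ : ℂ) :
    Module.Dual ℂ (weightSpace ρ (μ + 2)) →ₗ[ℂ] Module.Dual ℂ (weightSpace ρ μ) :=
  (raise ρ μ).dualMap

/-- The space of homomorphisms of `sl2`-modules from `(V, ρ)` to `(W, σ)`. -/
def intertwiners {W : Type} [AddCommGroup W] [Module ℂ W] (ρ : Rep V) (σ : Rep W) :
    Submodule ℂ (V →ₗ[ℂ] W) where
  carrier := {T | ∀ (A : sl2) (x : V), T (ρ A x) = σ A (T x)}
  add_mem' hS hT A x := by simp [hS A x, hT A x]
  zero_mem' A x := by simp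
  smul_mem' c T hT A x := by simp [hT A x]

/-- The multiplicity of an irreducible finite-dimensional module `(V, ρ)` in a finite-dimensional
module `(W, σ)`. -/
def multiplicity {W : Type} [AddCommGroup W] [Module ℂ W] (ρ : Rep V) (σ : Rep W) : ℕ :=
  Module.finrank ℂ (intertwiners ρ σ)

end construction

section verma

/-- `f^k v_a ↦ k (a - k + 1) f^(k-1) v_a`. -/
def vermaE (a : ℂ) : Module.End ℂ (ℕ →₀ ℂ) :=
  Finsupp.linearCombination ℂ
    (fun k : ℕ => Finsupp.single (k - 1) ((k : ℂ) * (a - k + 1)))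

/-- `f^k v_a ↦ f^(k+1) v_a`. -/
def vermaF : Module.End ℂ (ℕ →₀ ℂ) :=
  Finsupp.linearCombination ℂ (fun k : ℕ => Finsupp.single (k + 1) (1 : ℂ))

/-- `f^k v_a ↦ (a - 2 k) f^k v_a`. -/
def vermaH (a : ℂ) : Module.End ℂ (ℕ →₀ ℂ) :=
  Finsupp.linearCombination ℂ (fun k : ℕ => Finsupp.single k (a - 2 * (k : ℂ)))

/-- The Verma module `M_a`, on the space with basis `f^k v_a` (`k ≥ 0`), written
`Finsupp.single k 1`. -/
def verma (a : ℂ) : Rep (ℕ →₀ ℂ) :=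
  repOfTriple (vermaE a) vermaF (vermaH a)
    (by
      refine Finsupp.lhom_ext' fun k => LinearMap.ext_ring ?_
      rcases k with _ | k
      · simp [vermaE, vermaF, vermaH, -Finsupp.single_mul, -Finsupp.single_add, -Finsupp.single_sub]
      · simp only [vermaE, vermaF, vermaH, LinearMap.coe_comp, Function.comp_apply,
          LinearMap.sub_apply, Module.End.mul_apply, Finsupp.lsingle_apply,
          Finsupp.linearCombination_single, one_smul, Finsupp.smul_single, smul_eq_mul,
          Nat.add_sub_cancel, ← Finsupp.single_sub]
        congr 1
        push_cast
        ring)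
    (by
      refine Finsupp.lhom_ext' fun k => LinearMap.ext_ring ?_
      rcases k with _ | k
      · simp [vermaE, vermaH]
      · simp only [vermaE, vermaH, LinearMap.coe_comp, Function.comp_apply, LinearMap.smul_apply,
          LinearMap.sub_apply, Module.End.mul_apply, Finsupp.lsingle_apply,
          Finsupp.linearCombination_single, one_smul, Finsupp.smul_single, smul_eq_mul,
          Nat.add_sub_cancel, ← Finsupp.single_sub]
        congr 1
        push_cast
        ring)
    (by
      refine Finsupp.lhom_ext' fun k => LinearMap.ext_ring ?_
      simp only [vermaF, vermaH, LinearMap.coe_comp, Function.comp_apply, LinearMap.smul_apply,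
        LinearMap.sub_apply, Module.End.mul_apply, Finsupp.lsingle_apply,
        Finsupp.linearCombination_single, one_smul, Finsupp.smul_single, smul_eq_mul,
        ← Finsupp.single_sub]
      congr 1
      push_cast
      ring)

end verma

section irreducible

/-- `f^k v_p ↦ k (p - k + 1) f^(k-1) v_p`. -/
def irrE (p : ℕ) : Module.End ℂ (Fin (p + 1) →₀ ℂ) :=
  Finsupp.linearCombination ℂ (fun k : Fin (p + 1) =>
    Finsupp.single ⟨k.1 - 1, lt_of_le_of_lt (Nat.sub_le _ _) k.2⟩
      (((k.1 : ℕ) : ℂ) * ((p : ℂ) - (k.1 : ℕ) + 1)))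

/-- `f^k v_p ↦ f^(k+1) v_p`, where `f^(p+1) v_p = 0`. -/
def irrF (p : ℕ) : Module.End ℂ (Fin (p + 1) →₀ ℂ) :=
  Finsupp.linearCombination ℂ (fun k : Fin (p + 1) =>
    if hk : k.1 + 1 < p + 1 then Finsupp.single ⟨k.1 + 1, hk⟩ (1 : ℂ) else 0)

/-- `f^k v_p ↦ (p - 2 k) f^k v_p`. -/
def irrH (p : ℕ) : Module.End ℂ (Fin (p + 1) →₀ ℂ) :=
  Finsupp.linearCombination ℂ (fun k : Fin (p + 1) =>
    Finsupp.single k ((p : ℂ) - 2 * ((k.1 : ℕ) : ℂ)))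

/-- The irreducible module `L_p` of highest weight `p`, where `p` is a nonnegative integer, on the
space with basis `v_p, f v_p, …, f^p v_p`. -/
def irr (p : ℕ) : Rep (Fin (p + 1) →₀ ℂ) :=
  repOfTriple (irrE p) (irrF p) (irrH p)
    (by
      refine Finsupp.lhom_ext' fun k => LinearMap.ext_ring ?_
      obtain ⟨k, hk⟩ := k
      by_cases hk' : k + 1 < p + 1
      · rcases k with _ | k
        · have hp : 0 < p := by omega
          simp [irrE, irrF, irrH, hp, -Finsupp.single_mul, -Finsupp.single_add, -Finsupp.single_sub]
        · simp only [irrE, irrF, irrH, LinearMap.coe_comp, Function.comp_apply,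
            LinearMap.sub_apply, Module.End.mul_apply, Finsupp.lsingle_apply,
            Finsupp.linearCombination_single, one_smul, Finsupp.smul_single, smul_eq_mul,
            Nat.add_sub_cancel, hk', hk, dif_pos, ← Finsupp.single_sub]
          congr 1
          push_cast
          ring
      · obtain rfl : k = p := by omega
        rcases k with _ | k
        · simp [irrE, irrF, irrH]
        · simp only [irrE, irrF, irrH, LinearMap.coe_comp, Function.comp_apply,
            LinearMap.sub_apply, Module.End.mul_apply, Finsupp.lsingle_apply,
            Finsupp.linearCombination_single, one_smul, Finsupp.smul_single, smul_eq_mul,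
            Nat.add_sub_cancel, hk', hk, dif_pos, dif_neg, not_false_eq_true, map_zero, zero_sub,
            ← Finsupp.single_neg]
          congr 1
          push_cast
          ring)
    (by
      refine Finsupp.lhom_ext' fun k => LinearMap.ext_ring ?_
      obtain ⟨k, hk⟩ := k
      rcases k with _ | k
      · simp [irrE, irrH]
      · simp only [irrE, irrH, LinearMap.coe_comp, Function.comp_apply, LinearMap.smul_apply,
          LinearMap.sub_apply, Module.End.mul_apply, Finsupp.lsingle_apply,
          Finsupp.linearCombination_single, one_smul, Finsupp.smul_single, smul_eq_mul,
          Nat.add_sub_cancel, ← Finsupp.single_sub]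
        congr 1
        push_cast
        ring)
    (by
      refine Finsupp.lhom_ext' fun k => LinearMap.ext_ring ?_
      obtain ⟨k, hk⟩ := k
      by_cases hk' : k + 1 < p + 1
      · simp only [irrF, irrH, LinearMap.coe_comp, Function.comp_apply, LinearMap.smul_apply,
          LinearMap.sub_apply, Module.End.mul_apply, Finsupp.lsingle_apply,
          Finsupp.linearCombination_single, one_smul, Finsupp.smul_single, smul_eq_mul,
          hk', dif_pos, ← Finsupp.single_sub]
        congr 1
        push_cast
        ring
      · have hp : ¬ k < p := by omega
        simp [irrF, irrH, hp, -Finsupp.single_mul, -Finsupp.single_sub])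

end irreducible

section tensor

variable {n : ℕ} {V : Fin n → Type} [∀ i, AddCommGroup (V i)] [∀ i, Module ℂ (V i)]

/-- `1 ⊗ ⋯ ⊗ T ⊗ ⋯ ⊗ 1`, with the operator `T` in position `i`. -/
def actAt (i : Fin n) (T : Module.End ℂ (V i)) : Module.End ℂ (⨂[ℂ] i, V i) :=
  PiTensorProduct.map (Function.update (fun j => (1 : Module.End ℂ (V j))) i T)

theorem actAt_mul (i : Fin n) (S T : Module.End ℂ (V i)) :
    actAt i S * actAt i T = actAt i (S * T) := by
  unfold actAt
  rw [← PiTensorProduct.map_mul]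
  congr 1
  funext j
  rcases eq_or_ne j i with rfl | hj
  · simp
  · simp [hj]

theorem actAt_comm {i j : Fin n} (hij : i ≠ j) (S : Module.End ℂ (V i)) (T : Module.End ℂ (V j)) :
    actAt i S * actAt j T = actAt j T * actAt i S := by
  unfold actAt
  rw [← PiTensorProduct.map_mul, ← PiTensorProduct.map_mul]
  congr 1
  funext l
  rcases eq_or_ne l i with rfl | hi
  · simp [hij]
  · rcases eq_or_ne l j with rfl | hj
    · simp [hi]
    · simp [hi, hj]

theorem actAt_add (i : Fin n) (S T : Module.End ℂ (V i)) :
    actAt i (S + T) = actAt i S + actAt i T :=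
  PiTensorProduct.map_update_add _ i S T

theorem actAt_smul (i : Fin n) (c : ℂ) (T : Module.End ℂ (V i)) :
    actAt i (c • T) = c • actAt i T :=
  PiTensorProduct.map_update_smul _ i c T

theorem actAt_sub (i : Fin n) (S T : Module.End ℂ (V i)) :
    actAt i (S - T) = actAt i S - actAt i T := by
  rw [eq_sub_iff_add_eq, ← actAt_add, sub_add_cancel]

/-- The tensor product of the modules `(V i, ρ i)`: every `A` in `sl2` acts by
`∑ i, 1 ⊗ ⋯ ⊗ A ⊗ ⋯ ⊗ 1`. -/
def tensor (ρ : ∀ i, Rep (V i)) : Rep (⨂[ℂ] i, V i) where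
  toFun A := ∑ i, actAt i (ρ i A)
  map_add' A B := by simp only [map_add, actAt_add, Finset.sum_add_distrib]
  map_smul' c A := by
    simp only [map_smul, actAt_smul, Finset.smul_sum, RingHom.id_apply]
  map_lie' := by
    intro A B
    simp only [LieHom.map_lie, LieRing.of_associative_ring_bracket, actAt_sub, Finset.sum_mul_sum]
    rw [Finset.sum_comm (f := fun i j => actAt i (ρ i B) * actAt j (ρ j A)),
      ← Finset.sum_sub_distrib]
    refine Finset.sum_congr rfl fun i _ => ?_
    rw [← Finset.sum_sub_distrib, Finset.sum_eq_single i]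
    · rw [actAt_mul, actAt_mul]
    · intro j _ hj
      rw [actAt_comm hj.symm, sub_self]
    · simp

end tensor

/-- `|m| = m_1 + ⋯ + m_n`. -/
def size {n : ℕ} (m : Fin n → ℕ) : ℕ := ∑ i, m i

/-- `M^{⊗ m}`, the tensor product of the Verma modules `M_{m_1}, …, M_{m_n}`. -/
def vermaTensor {n : ℕ} (m : Fin n → ℕ) : Rep (⨂[ℂ] _i : Fin n, (ℕ →₀ ℂ)) :=
  tensor fun i => verma (m i)

/-- `L^{⊗ m}`, the tensor product of the irreducible modules `L_{m_1}, …, L_{m_n}`. -/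
def irrTensor {n : ℕ} (m : Fin n → ℕ) : Rep (⨂[ℂ] i : Fin n, (Fin (m i + 1) →₀ ℂ)) :=
  tensor fun i => irr (m i)

/-- `w(m, j)`, the multiplicity of `L_{|m| - 2j}` in `L^{⊗ m}`, which is zero if `|m| - 2j < 0`. -/
def w {n : ℕ} (m : Fin n → ℕ) (j : ℤ) : ℕ :=
  if 0 ≤ (size m : ℤ) - 2 * j then
    multiplicity (irr ((size m : ℤ) - 2 * j).toNat) (irrTensor m)
  else 0

/-- The map `f : (M^{⊗ m}[|m| - 2k + 2])^* → (M^{⊗ m}[|m| - 2k])^*`. -/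
def fMap {n : ℕ} (m : Fin n → ℕ) (k : ℕ) :
    Module.Dual ℂ (weightSpace (vermaTensor m) ((size m : ℂ) - 2 * (k : ℂ) + 2)) →ₗ[ℂ]
      Module.Dual ℂ (weightSpace (vermaTensor m) ((size m : ℂ) - 2 * (k : ℂ))) :=
  dualLower (vermaTensor m) ((size m : ℂ) - 2 * (k : ℂ))

end

end SlTwo

open scoped TensorProduct

namespace SlTwo

noncomputable section

attribute [local instance] LieRing.ofAssociativeRing

/-! ### Standard generators acting in a representation -/

section triple

variable {V : Type} [AddCommGroup V] [Module ℂ V]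

/-! An element of `ker f` is a functional on one weight space of M^{⊗m} that vanishes on the image
of e. Extended by zero to the other weight spaces, it becomes a functional Φ with Φ ∘ e = 0
(`extendWeight_e`). Such a Φ vanishes on every monomial having some exponent above m_i
(`apply_basis_eq_zero_of_comp_e`), so it descends to L^{⊗m}. There the contravariant form, for which
monomials are orthogonal with nonzero norms `tensorCoeff`, represents Φ by a unique vector u. Since
e and f are adjoint, Φ ∘ e = 0 means f u = 0. Hence `ker f` is the space of vectors of weight |m| -
2k + 2 in L^{⊗m} killed by f (`lowestEquivKer`).

Write this weight as -p, so p = 2k - 2 - |m| = |m| - 2(|m| - k + 1). If p ≥ 0, a homomorphism from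
L_p is determined by the image of the lowest vector, which can be any vector of weight -p killed by
f (`multiplicity_irr`); the dimension is therefore w(m, |m| - k + 1). If p < 0 there is no such
nonzero vector, by finite dimensionality; if |m| - k + 1 < 0 the weight lies below -|m|, the least
weight of L^{⊗m}.

For the cokernel, rank-nullity gives dim coker = dim ker plus the difference of the dimensions of
two weight spaces. These count multisets, and Pascal's rule evaluates the difference
(`finrank_weightSpace_eq_add`). -/

theorem repOfTriple_e (E F H : Module.End ℂ V) (hEF hHE hHF) :
    repOfTriple E F H hEF hHE hHF e = E := by
  change (1 : ℂ) • E + (0 : ℂ) • F + (0 : ℂ) • H = E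
  simp

theorem repOfTriple_f (E F H : Module.End ℂ V) (hEF hHE hHF) :
    repOfTriple E F H hEF hHE hHF f = F := by
  change (0 : ℂ) • E + (1 : ℂ) • F + (0 : ℂ) • H = F
  simp

theorem repOfTriple_h (E F H : Module.End ℂ V) (hEF hHE hHF) :
    repOfTriple E F H hEF hHE hHF h = H := by
  change (0 : ℂ) • E + (0 : ℂ) • F + (1 : ℂ) • H = H
  simp

theorem eq_combination (A : sl2) : A = A.1 0 1 • e + A.1 1 0 • f + A.1 0 0 • h := by
  have hA : A.1 1 1 = - A.1 0 0 := by
    have h0 : Matrix.trace A.1 = 0 := A.2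
    rw [Matrix.trace_fin_two] at h0
    linear_combination h0
  apply Subtype.ext
  ext i j
  fin_cases i <;> fin_cases j <;> simp [e, f, h, hA]

end triple

/-! ### Eigenspaces of diagonal operators -/

section diagonal

variable {ι V : Type} [AddCommGroup V] [Module ℂ V] (b : Module.Basis ι ℂ V)
  {H : Module.End ℂ V} {c : ι → ℂ}

/-- The eigenspaces of an operator that is diagonal in a basis are spanned by basis vectors. -/
theorem eigenspace_eq_span_of_diagonal (hH : ∀ i, H (b i) = c i • b i) (μ : ℂ) :
    Module.End.eigenspace H μ = Submodule.span ℂ (b '' {i | c i = μ}) := by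
  apply le_antisymm
  · intro x hx
    rw [Module.End.mem_eigenspace_iff] at hx
    rw [b.mem_span_image]
    have key : ∀ (x : V) (i : ι), b.repr (H x) i = c i * b.repr x i := by
      intro x i
      have : (Finsupp.lapply i ∘ₗ b.repr.toLinearMap) ∘ₗ H
          = c i • (Finsupp.lapply i ∘ₗ b.repr.toLinearMap) := by
        refine b.ext fun j => ?_
        rcases eq_or_ne i j with rfl | hij
        · simp [hH]
        · simp [hH, hij.symm]
      simpa using LinearMap.congr_fun this x
    intro i hi
    have h1 := key x i
    rw [hx] at h1
    have hi' : b.repr x i ≠ 0 := by simpa using hi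
    simp only [map_smul, Finsupp.smul_apply, smul_eq_mul] at h1
    exact (mul_right_cancel₀ hi' h1).symm
  · rw [Submodule.span_le]
    rintro _ ⟨i, rfl, rfl⟩
    simp [hH]

theorem finrank_eigenspace_of_diagonal (hH : ∀ i, H (b i) = c i • b i) (μ : ℂ) :
    Module.finrank ℂ (Module.End.eigenspace H μ) = Nat.card {i // c i = μ} := by
  rw [eigenspace_eq_span_of_diagonal b hH μ, Set.image_eq_range]
  exact Module.finrank_eq_nat_card_basis
    (Module.Basis.span (b.linearIndependent.comp (Subtype.val : {i // c i = μ} → ι)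
      Subtype.val_injective))

theorem finite_eigenspace_of_diagonal (hH : ∀ i, H (b i) = c i • b i) (μ : ℂ)
    (hfin : {i | c i = μ}.Finite) : Module.Finite ℂ (Module.End.eigenspace H μ) := by
  rw [eigenspace_eq_span_of_diagonal b hH μ]
  exact Module.Finite.span_of_finite ℂ (hfin.image b)

end diagonal

/-! ### Action on monomial bases of tensor products -/

section tensorAction

theorem actAt_tprod {n : ℕ} {V : Fin n → Type} [∀ i, AddCommGroup (V i)] [∀ i, Module ℂ (V i)]
    (i : Fin n) (T : Module.End ℂ (V i)) (x : ∀ i, V i) :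
    actAt i T (PiTensorProduct.tprod ℂ x) =
      PiTensorProduct.tprod ℂ (Function.update x i (T (x i))) := by
  rw [actAt, PiTensorProduct.map_tprod]
  congr 1
  funext j
  rcases eq_or_ne j i with rfl | hj
  · simp
  · simp [hj]

theorem tensor_tprod {n : ℕ} {V : Fin n → Type} [∀ i, AddCommGroup (V i)] [∀ i, Module ℂ (V i)]
    (ρ : ∀ i, Rep (V i)) (A : sl2) (x : ∀ i, V i) :
    tensor ρ A (PiTensorProduct.tprod ℂ x) =
      ∑ i, PiTensorProduct.tprod ℂ (Function.update x i (ρ i A (x i))) := by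
  change (∑ i, actAt i (ρ i A)) _ = _
  simp [actAt_tprod]

variable {n : ℕ} (m : Fin n → ℕ)

/-- The monomial basis of a tensor product of Verma modules. -/
def vermaBasis (n : ℕ) : Module.Basis (Fin n → ℕ) ℂ (⨂[ℂ] _i : Fin n, (ℕ →₀ ℂ)) :=
  Basis.piTensorProduct fun _ => Finsupp.basisSingleOne

/-- The monomial basis of a tensor product of irreducible modules. -/
def irrBasis : Module.Basis (∀ i, Fin (m i + 1)) ℂ (⨂[ℂ] i : Fin n, (Fin (m i + 1) →₀ ℂ)) :=
  Basis.piTensorProduct fun _ => Finsupp.basisSingleOne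

theorem vermaBasis_apply (J : Fin n → ℕ) :
    vermaBasis n J = PiTensorProduct.tprod ℂ fun i => Finsupp.single (J i) (1 : ℂ) := by
  simp [vermaBasis]

theorem irrBasis_apply (J : ∀ i, Fin (m i + 1)) :
    irrBasis m J = PiTensorProduct.tprod ℂ fun i => Finsupp.single (J i) (1 : ℂ) := by
  simp [irrBasis]

theorem tprod_update_single {n : ℕ} {κ : Fin n → Type} (J : ∀ i, κ i) (i : Fin n) (j : κ i)
    (c : ℂ) :
    (PiTensorProduct.tprod ℂ (Function.update (fun l => Finsupp.single (J l) (1 : ℂ)) i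
      (Finsupp.single j c)) : ⨂[ℂ] i : Fin n, (κ i →₀ ℂ)) =
      c • PiTensorProduct.tprod ℂ fun l => Finsupp.single (Function.update J i j l) (1 : ℂ) := by
  have : (Finsupp.single j c : κ i →₀ ℂ) = c • Finsupp.single j 1 := by simp
  rw [this, MultilinearMap.map_update_smul]
  congr 2
  funext l
  rcases eq_or_ne l i with rfl | hl
  · simp
  · simp [hl]

theorem vermaTensor_e (J : Fin n → ℕ) :
    vermaTensor m e (vermaBasis n J) =
      ∑ i, ((J i : ℂ) * (m i - J i + 1)) • vermaBasis n (Function.update J i (J i - 1)) := by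
  rw [vermaTensor, vermaBasis_apply, tensor_tprod]
  refine Finset.sum_congr rfl fun i _ => ?_
  rw [verma, repOfTriple_e, vermaE, Finsupp.linearCombination_single, one_smul,
    tprod_update_single (κ := fun _ => ℕ), vermaBasis_apply]

theorem vermaTensor_h (J : Fin n → ℕ) :
    vermaTensor m h (vermaBasis n J) =
      ((size m : ℂ) - 2 * ((∑ i, J i : ℕ) : ℂ)) • vermaBasis n J := by
  rw [vermaTensor, vermaBasis_apply, tensor_tprod]
  have : ((size m : ℂ) - 2 * ((∑ i, J i : ℕ) : ℂ)) = ∑ i, ((m i : ℂ) - 2 * (J i : ℂ)) := by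
    simp [size, Finset.mul_sum]
  rw [this, Finset.sum_smul]
  refine Finset.sum_congr rfl fun i _ => ?_
  rw [verma, repOfTriple_h, vermaH, Finsupp.linearCombination_single, one_smul,
    tprod_update_single (κ := fun _ => ℕ), Function.update_eq_self]

theorem irrTensor_f (J : ∀ i, Fin (m i + 1)) :
    irrTensor m f (irrBasis m J) =
      ∑ i, if hi : (J i).1 + 1 < m i + 1 then
        irrBasis m (Function.update J i ⟨(J i).1 + 1, hi⟩) else 0 := by
  rw [irrTensor, irrBasis_apply, tensor_tprod]
  refine Finset.sum_congr rfl fun i _ => ?_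
  rw [irr, repOfTriple_f, irrF, Finsupp.linearCombination_single, one_smul]
  split_ifs with hi
  · rw [tprod_update_single, one_smul, irrBasis_apply]
  · rw [MultilinearMap.map_update_zero]

theorem irrTensor_h (J : ∀ i, Fin (m i + 1)) :
    irrTensor m h (irrBasis m J) =
      ((size m : ℂ) - 2 * ((∑ i, (J i).1 : ℕ) : ℂ)) • irrBasis m J := by
  rw [irrTensor, irrBasis_apply, tensor_tprod]
  have : ((size m : ℂ) - 2 * ((∑ i, (J i).1 : ℕ) : ℂ)) = ∑ i, ((m i : ℂ) - 2 * ((J i).1 : ℂ)) := by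
    simp [size, Finset.mul_sum]
  rw [this, Finset.sum_smul]
  refine Finset.sum_congr rfl fun i _ => ?_
  rw [irr, repOfTriple_h, irrH, Finsupp.linearCombination_single, one_smul,
    tprod_update_single, Function.update_eq_self]

end tensorAction

/-! ### Dimensions of the weight spaces of M^{⊗m} -/

section dimension

variable {n : ℕ} (m : Fin n → ℕ)

theorem natCard_tuples_sum_eq (n k : ℕ) :
    Nat.card {J : Fin n → ℕ // ∑ i, J i = k} = n.multichoose k := by
  rw [Nat.card_congr (Sym.equivNatSumOfFintype (Fin n) k).symm]
  simp [Sym.card_sym_eq_multichoose]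

theorem weight_eq_iff (N a k : ℕ) : (N : ℂ) - 2 * (a : ℂ) = N - 2 * (k : ℂ) ↔ a = k := by
  constructor
  · intro hk
    have : (a : ℂ) = k := by linear_combination -hk / 2
    exact_mod_cast this
  · rintro rfl; rfl

theorem finrank_weightSpace_vermaTensor (k : ℕ) :
    Module.finrank ℂ (weightSpace (vermaTensor m) ((size m : ℂ) - 2 * (k : ℂ))) =
      n.multichoose k := by
  rw [weightSpace, finrank_eigenspace_of_diagonal (vermaBasis n) (vermaTensor_h m),
    ← natCard_tuples_sum_eq]
  simp only [weight_eq_iff]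

/-- Arbitrary μ is allowed because |m| - 2k + 2 is not of the form |m| - 2k' with k' natural when k
= 0. Finiteness holds since each exponent is bounded by the prescribed sum. -/
theorem finite_weightSpace_vermaTensor (μ : ℂ) :
    Module.Finite ℂ (weightSpace (vermaTensor m) μ) := by
  apply finite_eigenspace_of_diagonal (vermaBasis n) (vermaTensor_h m)
  by_cases hμ : ∃ J₀ : Fin n → ℕ, (size m : ℂ) - 2 * ((∑ i, J₀ i : ℕ) : ℂ) = μ
  · obtain ⟨J₀, rfl⟩ := hμ
    simp only [weight_eq_iff]
    refine (Set.finite_Iic (fun _ : Fin n => ∑ i, J₀ i)).subset fun J hJ i => ?_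
    rw [← (hJ : ∑ i, J i = ∑ i, J₀ i)]
    exact Finset.single_le_sum (fun _ _ => Nat.zero_le _) (Finset.mem_univ i)
  · convert Set.finite_empty
    ext J
    simp only [Set.mem_ofPred_eq, Set.mem_empty_iff_false, iff_false]
    exact fun hJ => hμ ⟨J, hJ⟩

end dimension

/-- `∏ (l + 1) (a - l)` over `l < j`: the coefficient of `v_a` in `e^j f^j v_a`. -/
def vermaCoeff (a j : ℕ) : ℂ := ∏ l ∈ Finset.range j, (((l : ℂ) + 1) * ((a : ℂ) - l))

theorem vermaCoeff_succ (a j : ℕ) :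
    vermaCoeff a (j + 1) = vermaCoeff a j * (((j : ℂ) + 1) * ((a : ℂ) - j)) :=
  Finset.prod_range_succ _ _

theorem vermaCoeff_ne_zero {a j : ℕ} (hj : j ≤ a) : vermaCoeff a j ≠ 0 := by
  refine Finset.prod_ne_zero_iff.2 fun l hl => mul_ne_zero (Nat.cast_add_one_ne_zero l) ?_
  have : l < a := (Finset.mem_range.1 hl).trans_le hj
  exact sub_ne_zero.2 (by exact_mod_cast this.ne')

/-! ### Vectors killed by f in finite-dimensional modules -/

section lowest

variable {W : Type} [AddCommGroup W] [Module ℂ W] (σ : Rep W)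

/-- The vectors of weight `μ` that are killed by `f`. -/
def lowestVectors (μ : ℂ) : Submodule ℂ W := weightSpace σ μ ⊓ LinearMap.ker (σ f)

theorem mem_lowestVectors {μ : ℂ} {u : W} :
    u ∈ lowestVectors σ μ ↔ σ h u = μ • u ∧ σ f u = 0 := by
  simp [lowestVectors, weightSpace]

/-- Used through `.symm`, which swaps e with f and negates h: a vector of weight μ killed by f
becomes a primitive vector of weight -μ, and the highest weight theory applies. -/
theorem isSl2Triple_h_e_f : IsSl2Triple h e f where
  h_ne_zero h0 := by
    have := congrArg (fun A : sl2 => A.1 0 0) h0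
    simp [h] at this
  lie_e_f := lie_e_f
  lie_h_e_nsmul := by rw [lie_h_e, two_smul, two_nsmul]
  lie_h_f_nsmul := by rw [lie_h_f, neg_smul, two_smul, two_nsmul]

theorem exists_nat_of_mem_lowestVectors [FiniteDimensional ℂ W] {μ : ℂ} {u : W} (hu : u ∈ lowestVectors σ μ)
    (hu0 : u ≠ 0) : ∃ p : ℕ, μ = -p := by
  let _ : LieRingModule sl2 W := LieRingModule.compLieHom W σ
  have _ : LieModule ℂ sl2 W := LieModule.compLieHom W σ
  rw [mem_lowestVectors] at hu
  have P : isSl2Triple_h_e_f.symm.HasPrimitiveVectorWith u (-μ) :=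
    ⟨hu0, by rw [neg_lie, neg_smul]; exact congrArg Neg.neg hu.1, hu.2⟩
  obtain ⟨p, hp⟩ := P.exists_nat
  exact ⟨p, by rw [← hp, neg_neg]⟩

theorem f_e_pow_succ {p : ℕ} {u : W} (hu : u ∈ lowestVectors σ (-p)) (q : ℕ) :
    σ f ((σ e ^ (q + 1)) u) = (((q : ℂ) + 1) * ((p : ℂ) - q)) • (σ e ^ q) u := by
  rcases eq_or_ne u 0 with rfl | hu0
  · simp
  let _ : LieRingModule sl2 W := LieRingModule.compLieHom W σ
  have _ : LieModule ℂ sl2 W := LieModule.compLieHom W σ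
  rw [mem_lowestVectors] at hu
  have P : isSl2Triple_h_e_f.symm.HasPrimitiveVectorWith u (p : ℂ) :=
    ⟨hu0, by rw [neg_lie]; exact (congrArg Neg.neg hu.1).trans (by simp), hu.2⟩
  exact P.lie_e_pow_succ_toEnd_f q

theorem e_pow_eq_zero [FiniteDimensional ℂ W] {p : ℕ} {u : W} (hu : u ∈ lowestVectors σ (-p)) :
    (σ e ^ (p + 1)) u = 0 := by
  rcases eq_or_ne u 0 with rfl | hu0
  · simp
  let _ : LieRingModule sl2 W := LieRingModule.compLieHom W σ
  have _ : LieModule ℂ sl2 W := LieModule.compLieHom W σ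
  rw [mem_lowestVectors] at hu
  have P : isSl2Triple_h_e_f.symm.HasPrimitiveVectorWith u (p : ℂ) :=
    ⟨hu0, by rw [neg_lie]; exact (congrArg Neg.neg hu.1).trans (by simp), hu.2⟩
  exact P.pow_toEnd_f_eq_zero_of_eq_nat rfl

end lowest

/-! ### Homomorphisms from L_p and lowest weight vectors -/

section intertwiners

variable {V W : Type} [AddCommGroup V] [Module ℂ V] [AddCommGroup W] [Module ℂ W]

theorem mem_intertwiners_of_e_f {ρ : Rep V} {σ : Rep W} {T : V →ₗ[ℂ] W}
    (he : T ∘ₗ ρ e = σ e ∘ₗ T) (hf : T ∘ₗ ρ f = σ f ∘ₗ T) : T ∈ intertwiners ρ σ := by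
  replace he : ∀ x, T (ρ e x) = σ e (T x) := LinearMap.congr_fun he
  replace hf : ∀ x, T (ρ f x) = σ f (T x) := LinearMap.congr_fun hf
  have hh : ∀ x, T (ρ h x) = σ h (T x) := fun x => by
    simp only [← lie_e_f, LieHom.map_lie, LieRing.of_associative_ring_bracket,
      LinearMap.sub_apply, Module.End.mul_apply, map_sub, he, hf]
  intro A x
  rw [eq_combination A]
  simp only [map_add, map_smul, LinearMap.add_apply, LinearMap.smul_apply, he, hf, hh]

theorem irr_e_single (p : ℕ) (j : Fin (p + 1)) :
    irr p e (Finsupp.single j 1) =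
      ((j.1 : ℂ) * ((p : ℂ) - j.1 + 1)) •
        Finsupp.single ⟨j.1 - 1, lt_of_le_of_lt (Nat.sub_le _ _) j.2⟩ 1 := by
  rw [irr, repOfTriple_e, irrE, Finsupp.linearCombination_single, one_smul,
    Finsupp.smul_single, smul_eq_mul, mul_one]

theorem irr_f_single (p : ℕ) (j : Fin (p + 1)) :
    irr p f (Finsupp.single j 1) =
      if hj : j.1 + 1 < p + 1 then Finsupp.single ⟨j.1 + 1, hj⟩ 1 else 0 := by
  rw [irr, repOfTriple_f, irrF, Finsupp.linearCombination_single, one_smul]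

theorem irr_h_single (p : ℕ) (j : Fin (p + 1)) :
    irr p h (Finsupp.single j 1) = ((p : ℂ) - 2 * (j.1 : ℂ)) • Finsupp.single j 1 := by
  rw [irr, repOfTriple_h, irrH, Finsupp.linearCombination_single, one_smul,
    Finsupp.smul_single, smul_eq_mul, mul_one]

theorem single_last_mem_lowestVectors (p : ℕ) :
    Finsupp.single (Fin.last p) (1 : ℂ) ∈ lowestVectors (irr p) (-p) := by
  rw [mem_lowestVectors, irr_h_single, irr_f_single]
  refine ⟨?_, dif_neg (by simp)⟩
  congr 1
  simp only [Fin.val_last]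
  ring

theorem intertwiner_mem_lowestVectors {ρ : Rep V} {σ : Rep W} {T : V →ₗ[ℂ] W}
    (hT : T ∈ intertwiners ρ σ) {μ : ℂ} {x : V} (hx : x ∈ lowestVectors ρ μ) :
    T x ∈ lowestVectors σ μ := by
  rw [mem_lowestVectors] at hx ⊢
  rw [← hT h x, ← hT f x, hx.1, hx.2]
  simp

/-- The lowest vector generates L_p under e: the coefficient (j + 1)(p - j) of e on f^(j+1) v_p is
nonzero for j < p, so vanishing propagates upwards from f^p v_p. -/
theorem intertwiner_eq_zero_of_single_last {p : ℕ} {σ : Rep W} {T : (Fin (p + 1) →₀ ℂ) →ₗ[ℂ] W}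
    (hT : T ∈ intertwiners (irr p) σ) (h0 : T (Finsupp.single (Fin.last p) 1) = 0) : T = 0 := by
  refine Finsupp.lhom_ext' fun j => LinearMap.ext_ring ?_
  change T (Finsupp.single j 1) = 0
  induction j using Fin.reverseInduction with
  | last => exact h0
  | cast j ih =>
    have key := hT e (Finsupp.single j.succ 1)
    rw [ih, map_zero, irr_e_single, map_smul, smul_eq_zero] at key
    refine key.resolve_left (mul_ne_zero (by simp [Nat.cast_add_one_ne_zero]) ?_)
    have h1 : ((p : ℂ) - (j.succ : Fin (p + 1)).1 + 1) = (p - j.1 : ℂ) := by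
      simp only [Fin.val_succ]; push_cast; ring
    rw [h1]
    exact sub_ne_zero.2 (by exact_mod_cast j.2.ne')

/-- The linear map from `L_p` that sends `f^j v_p` to a multiple of `e^(p - j) u`. -/
def irrToLowest (p : ℕ) (σ : Rep W) (u : W) : (Fin (p + 1) →₀ ℂ) →ₗ[ℂ] W :=
  Finsupp.linearCombination ℂ fun j : Fin (p + 1) => vermaCoeff p j.1 • (σ e ^ (p - j.1)) u

theorem irrToLowest_single (p : ℕ) (σ : Rep W) (u : W) (j : Fin (p + 1)) :
    irrToLowest p σ u (Finsupp.single j 1) = vermaCoeff p j.1 • (σ e ^ (p - j.1)) u := by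
  simp [irrToLowest]

variable [FiniteDimensional ℂ W]

/-- The recursion c_{j+1} = (j + 1)(p - j) c_j of `vermaCoeff` is what both relations demand: it is
the coefficient of e on f^(j+1) v_p and that of f on e^(p-j) u. -/
theorem irrToLowest_mem_intertwiners {p : ℕ} {σ : Rep W} {u : W}
    (hu : u ∈ lowestVectors σ (-p)) : irrToLowest p σ u ∈ intertwiners (irr p) σ := by
  apply mem_intertwiners_of_e_f
  · refine Finsupp.lhom_ext' fun j => LinearMap.ext_ring ?_
    change irrToLowest p σ u (irr p e (Finsupp.single j 1)) =
      σ e (irrToLowest p σ u (Finsupp.single j 1))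
    rw [irr_e_single, map_smul, irrToLowest_single, irrToLowest_single, map_smul,
      ← Module.End.mul_apply, ← pow_succ']
    obtain ⟨_ | j, hj⟩ := j
    -- The top vector must be killed by e, that is, e^(p+1) u = 0.
    · simp [e_pow_eq_zero σ hu]
    · have hp : p - (j + 1) + 1 = p - j := by omega
      simp only [Nat.add_sub_cancel, vermaCoeff_succ, smul_smul, hp]
      congr 1
      push_cast
      ring
  · refine Finsupp.lhom_ext' fun j => LinearMap.ext_ring ?_
    change irrToLowest p σ u (irr p f (Finsupp.single j 1)) =
      σ f (irrToLowest p σ u (Finsupp.single j 1))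
    rw [irr_f_single, irrToLowest_single, map_smul]
    obtain ⟨j, hj⟩ := j
    split_ifs with hj'
    · have hp : p - j = p - (j + 1) + 1 := by simp only at hj'; omega
      simp only [hp, f_e_pow_succ σ hu, irrToLowest_single, vermaCoeff_succ, smul_smul]
      congr 1
      have : ((p - (j + 1) : ℕ) : ℂ) = p - (j + 1) := by
        rw [Nat.cast_sub (by simp only at hj'; omega)]; push_cast; ring
      rw [this]
      ring
    · obtain rfl : j = p := by simp only at hj'; omega
      simp [((mem_lowestVectors σ).1 hu).2]

/-- Homomorphisms from `L_p` correspond to vectors of weight `-p` killed by `f`. -/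
def intertwinersEquivLowest (p : ℕ) (σ : Rep W) :
    intertwiners (irr p) σ ≃ₗ[ℂ] lowestVectors σ (-p) :=
  LinearEquiv.ofBijective
    (((LinearMap.applyₗ (Finsupp.single (Fin.last p) (1 : ℂ))).comp
      (intertwiners (irr p) σ).subtype).codRestrict (lowestVectors σ (-p)) fun T =>
        intertwiner_mem_lowestVectors T.2 (single_last_mem_lowestVectors p)) <| by
    constructor
    · rw [← LinearMap.ker_eq_bot, LinearMap.ker_eq_bot']
      intro T hT
      exact Subtype.ext (intertwiner_eq_zero_of_single_last T.2 (congrArg Subtype.val hT))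
    · intro u
      -- The map built from u sends f^p v_p to c_p u, hence the rescaling by c_p⁻¹.
      refine ⟨⟨irrToLowest p σ ((vermaCoeff p p)⁻¹ • u), irrToLowest_mem_intertwiners
        (Submodule.smul_mem _ _ u.2)⟩, Subtype.ext ?_⟩
      change irrToLowest p σ ((vermaCoeff p p)⁻¹ • (u : W)) (Finsupp.single (Fin.last p) 1) = u
      rw [irrToLowest_single]
      simp [smul_smul, vermaCoeff_ne_zero]

theorem multiplicity_irr (p : ℕ) (σ : Rep W) :
    multiplicity (irr p) σ = Module.finrank ℂ (lowestVectors σ (-p)) :=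
  (intertwinersEquivLowest p σ).finrank_eq

end intertwiners

/-! ### The contravariant pairing of L^{⊗m} with M^{⊗m} -/

section pairing

variable {n : ℕ} (m : Fin n → ℕ)

/-- The square norm of the basis vector with exponents `J` for the contravariant form. -/
def tensorCoeff (J : Fin n → ℕ) : ℂ := ∏ i, vermaCoeff (m i) (J i)

theorem tensorCoeff_update_succ (J : Fin n → ℕ) (i : Fin n) :
    tensorCoeff m (Function.update J i (J i + 1)) =
      ((J i : ℂ) + 1) * ((m i : ℂ) - J i) * tensorCoeff m J := by
  rw [tensorCoeff, tensorCoeff, ← Finset.mul_prod_erase _ _ (Finset.mem_univ i),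
    ← Finset.mul_prod_erase (a := i) Finset.univ (fun i => vermaCoeff (m i) (J i))
      (Finset.mem_univ i), Function.update_self, vermaCoeff_succ]
  have : ∏ x ∈ Finset.univ.erase i, vermaCoeff (m x) (Function.update J i (J i + 1) x) =
      ∏ x ∈ Finset.univ.erase i, vermaCoeff (m x) (J x) :=
    Finset.prod_congr rfl fun x hx => by rw [Function.update_of_ne (Finset.ne_of_mem_erase hx)]
  rw [this]
  ring

theorem tensorCoeff_ne_zero (J : ∀ i, Fin (m i + 1)) :
    tensorCoeff m (fun i => (J i).1) ≠ 0 :=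
  Finset.prod_ne_zero_iff.2 fun i _ => vermaCoeff_ne_zero (Nat.lt_succ_iff.1 (J i).2)

/-- The contravariant pairing between `L^{⊗ m}` and `M^{⊗ m}`. -/
def pairing : (⨂[ℂ] i : Fin n, (Fin (m i + 1) →₀ ℂ)) →ₗ[ℂ]
    Module.Dual ℂ (⨂[ℂ] _i : Fin n, (ℕ →₀ ℂ)) :=
  (irrBasis m).constr ℂ fun J =>
    tensorCoeff m (fun i => (J i).1) • (vermaBasis n).coord (fun i => (J i).1)

theorem pairing_basis (J : ∀ i, Fin (m i + 1)) (K : Fin n → ℕ) :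
    pairing m (irrBasis m J) (vermaBasis n K) =
      if K = (fun i => (J i).1) then tensorCoeff m K else 0 := by
  rw [pairing, Module.Basis.constr_basis]
  split_ifs with hK
  · subst hK; simp
  · simp [hK]

/-- Contravariance holds factor by factor: in position i both sides vanish unless K is J with its
i-th exponent raised by one, and then `tensorCoeff_update_succ` matches them. -/
theorem pairing_f (u : ⨂[ℂ] i : Fin n, (Fin (m i + 1) →₀ ℂ)) (x : ⨂[ℂ] _i : Fin n, (ℕ →₀ ℂ)) :
    pairing m (irrTensor m f u) x = pairing m u (vermaTensor m e x) := by
  suffices hb : pairing m ∘ₗ irrTensor m f =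
      (Module.Dual.transpose (R := ℂ) (vermaTensor m e)) ∘ₗ pairing m by
    exact LinearMap.congr_fun (LinearMap.congr_fun hb u) x
  refine (irrBasis m).ext fun J => (vermaBasis n).ext fun K => ?_
  change pairing m (irrTensor m f (irrBasis m J)) (vermaBasis n K) =
    pairing m (irrBasis m J) (vermaTensor m e (vermaBasis n K))
  rw [irrTensor_f, vermaTensor_e, map_sum, map_sum, LinearMap.sum_apply]
  refine Finset.sum_congr rfl fun i _ => ?_
  rw [map_smul, pairing_basis, smul_eq_mul]
  by_cases hK : K = Function.update (fun i => (J i).1) i ((J i).1 + 1)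
  · have hK' : Function.update K i (K i - 1) = fun i => (J i).1 := by
      rw [hK]
      simp
    have hKi : K i = (J i).1 + 1 := by rw [hK]; simp
    rw [hK', if_pos rfl, hKi]
    split_ifs with hi
    · rw [pairing_basis, if_pos, hK, tensorCoeff_update_succ]
      · push_cast; ring
      · rw [hK]
        funext l
        rcases eq_or_ne l i with rfl | hl
        · simp
        · simp [hl]
    -- Boundary case: f kills the lowest vector of L_{m_i}, and e kills f^(m_i+1) v in the Verma
    -- module.
    · have : (J i).1 = m i := by have := (J i).2; omega
      rw [this]
      simp
  · have hL : (pairing m (if hi : (J i).1 + 1 < m i + 1 then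
        irrBasis m (Function.update J i ⟨(J i).1 + 1, hi⟩) else 0)) (vermaBasis n K) = 0 := by
      split_ifs with hi
      · rw [pairing_basis, if_neg]
        rintro rfl
        apply hK
        funext l
        rcases eq_or_ne l i with rfl | hl
        · simp
        · simp [hl]
      · simp
    rw [hL]
    -- For K_i = 0 the truncated exponent K_i - 1 is harmless, as its coefficient is zero.
    rcases Nat.eq_zero_or_pos (K i) with h0 | h0
    · simp [h0]
    · rw [if_neg, mul_zero]
      intro hK'
      apply hK
      have hKi : K i - 1 = (J i).1 := by simpa using congrFun hK' i
      rw [← hKi, ← hK', Nat.sub_add_cancel h0]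
      simp

theorem pairing_h (u : ⨂[ℂ] i : Fin n, (Fin (m i + 1) →₀ ℂ)) (x : ⨂[ℂ] _i : Fin n, (ℕ →₀ ℂ)) :
    pairing m (irrTensor m h u) x = pairing m u (vermaTensor m h x) := by
  suffices hb : pairing m ∘ₗ irrTensor m h =
      (Module.Dual.transpose (R := ℂ) (vermaTensor m h)) ∘ₗ pairing m by
    exact LinearMap.congr_fun (LinearMap.congr_fun hb u) x
  refine (irrBasis m).ext fun J => (vermaBasis n).ext fun K => ?_
  change pairing m (irrTensor m h (irrBasis m J)) (vermaBasis n K) =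
    pairing m (irrBasis m J) (vermaTensor m h (vermaBasis n K))
  rw [irrTensor_h, vermaTensor_h, map_smul, LinearMap.smul_apply, map_smul, pairing_basis]
  split_ifs with hK
  · rw [hK]
  · simp

theorem pairing_apply_basis (u : ⨂[ℂ] i : Fin n, (Fin (m i + 1) →₀ ℂ)) (J : ∀ i, Fin (m i + 1)) :
    pairing m u (vermaBasis n fun i => (J i).1) =
      (irrBasis m).repr u J * tensorCoeff m (fun i => (J i).1) := by
  suffices hb : (LinearMap.applyₗ (vermaBasis n fun i => (J i).1)) ∘ₗ pairing m =
      tensorCoeff m (fun i => (J i).1) • (irrBasis m).coord J from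
    (LinearMap.congr_fun hb u).trans (mul_comm _ _)
  refine (irrBasis m).ext fun K => ?_
  change pairing m (irrBasis m K) _ = tensorCoeff m _ • (irrBasis m).coord J (irrBasis m K)
  rw [pairing_basis]
  rcases eq_or_ne J K with rfl | hJK
  · simp
  · rw [if_neg]
    · simp [hJK.symm]
    · exact fun hJK' => hJK (funext fun i => Fin.ext (congrFun hJK' i))

theorem pairing_injective : Function.Injective (pairing m) := by
  refine (injective_iff_map_eq_zero _).2 ?_
  intro u hu
  refine (irrBasis m).ext_elem fun J => ?_
  have := pairing_apply_basis m u J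
  rw [hu, LinearMap.zero_apply] at this
  simpa [tensorCoeff_ne_zero] using this.symm

theorem pairing_apply_basis_eq_zero (u : ⨂[ℂ] i : Fin n, (Fin (m i + 1) →₀ ℂ)) {K : Fin n → ℕ}
    {i : Fin n} (hK : m i < K i) : pairing m u (vermaBasis n K) = 0 := by
  suffices hb : (LinearMap.applyₗ (vermaBasis n K)) ∘ₗ pairing m = 0 from
    LinearMap.congr_fun hb u
  refine (irrBasis m).ext fun J => ?_
  change pairing m (irrBasis m J) _ = _
  rw [pairing_basis, if_neg]
  · rfl
  · rintro rfl
    exact hK.not_ge (Nat.lt_succ_iff.1 (J i).2)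

/-- A functional on `M^{⊗ m}` that vanishes on the image of `e` vanishes on the kernel of
`M^{⊗ m} → L^{⊗ m}`. -/
theorem apply_basis_eq_zero_of_comp_e {Φ : Module.Dual ℂ (⨂[ℂ] _i : Fin n, (ℕ →₀ ℂ))}
    (hΦ : Φ ∘ₗ vermaTensor m e = 0) {i : Fin n} {K : Fin n → ℕ} (hK : m i < K i) :
    Φ (vermaBasis n K) = 0 := by
  -- Evaluate Φ ∘ e on the monomial with K_i raised by one. Position i contributes (K_i + 1)(m_i -
  -- K_i) Φ(K), with nonzero coefficient; every other position lowers some K_l and keeps the i-th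
  -- exponent above m_i, so it vanishes by induction on the sum of the other exponents.
  induction hs : ∑ l ∈ Finset.univ.erase i, K l using Nat.strong_induction_on generalizing K with
  | _ s ih =>
    have key := LinearMap.congr_fun hΦ (vermaBasis n (Function.update K i (K i + 1)))
    rw [LinearMap.comp_apply, vermaTensor_e, map_sum, LinearMap.zero_apply,
      Finset.sum_eq_single i] at key
    · simp only [Function.update_self, Nat.add_sub_cancel, Function.update_idem,
        Function.update_eq_self, map_smul, smul_eq_zero] at key
      refine key.resolve_left (mul_ne_zero (Nat.cast_ne_zero.2 (Nat.succ_ne_zero _)) ?_)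
      have : ((m i : ℂ) - (K i + 1 : ℕ) + 1) = m i - K i := by push_cast; ring
      rw [this]
      exact sub_ne_zero.2 (by exact_mod_cast hK.ne)
    · intro l _ hl
      rw [Function.update_of_ne hl, map_smul]
      rcases Nat.eq_zero_or_pos (K l) with h0 | h0
      · simp [h0]
      · rw [ih _ ?_ ?_ rfl, smul_zero]
        · rw [← hs]
          refine Finset.sum_lt_sum (fun j hj => ?_) ⟨l, by simp [hl], ?_⟩
          · rcases eq_or_ne j l with rfl | hjl
            · simp
            · simp [hjl, Finset.ne_of_mem_erase hj]
          · simp only [Function.update_self]; omega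
        · rw [Function.update_of_ne hl.symm, Function.update_self]
          omega
    · simp

/-- On monomials with all exponents at most m_i the norms are invertible, so u is read off from the
values of Φ; on the others both sides vanish. -/
theorem exists_pairing_eq {Φ : Module.Dual ℂ (⨂[ℂ] _i : Fin n, (ℕ →₀ ℂ))}
    (hΦ : Φ ∘ₗ vermaTensor m e = 0) : ∃ u, pairing m u = Φ := by
  refine ⟨∑ J : ∀ i, Fin (m i + 1), (Φ (vermaBasis n fun i => (J i).1) *
    (tensorCoeff m fun i => (J i).1)⁻¹) • irrBasis m J, (vermaBasis n).ext fun K => ?_⟩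
  by_cases hK : ∀ i, K i < m i + 1
  · obtain ⟨J, rfl⟩ : ∃ J : ∀ i, Fin (m i + 1), K = fun i => (J i).1 :=
      ⟨fun i => ⟨K i, hK i⟩, rfl⟩
    rw [pairing_apply_basis, Module.Basis.repr_sum_self, mul_assoc,
      inv_mul_cancel₀ (tensorCoeff_ne_zero m J), mul_one]
  · push Not at hK
    obtain ⟨i, hi⟩ := hK
    rw [pairing_apply_basis_eq_zero m _ hi, apply_basis_eq_zero_of_comp_e m hΦ hi]

end pairing

/-! ### The kernel as lowest weight vectors of L^{⊗m} -/

section kernel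

variable {n : ℕ} (m : Fin n → ℕ)

open Classical in
/-- A functional on a weight space, extended by zero to all other weight spaces. -/
def extendWeight {μ : ℂ} (φ : Module.Dual ℂ (weightSpace (vermaTensor m) μ)) :
    Module.Dual ℂ (⨂[ℂ] _i : Fin n, (ℕ →₀ ℂ)) :=
  (vermaBasis n).constr ℂ fun J =>
    if hJ : vermaBasis n J ∈ weightSpace (vermaTensor m) μ then φ ⟨_, hJ⟩ else 0

theorem vermaBasis_mem_weightSpace (J : Fin n → ℕ) (μ : ℂ) :
    vermaBasis n J ∈ weightSpace (vermaTensor m) μ ↔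
      (size m : ℂ) - 2 * ((∑ i, J i : ℕ) : ℂ) = μ := by
  rw [weightSpace, Module.End.mem_eigenspace_iff, vermaTensor_h]
  have h0 : vermaBasis n J ≠ 0 := (vermaBasis n).ne_zero J
  exact smul_left_inj h0

theorem extendWeight_of_mem {μ : ℂ} (φ : Module.Dual ℂ (weightSpace (vermaTensor m) μ))
    (x : weightSpace (vermaTensor m) μ) : extendWeight m φ x = φ x := by
  obtain ⟨x, hx⟩ := x
  have hx' := hx
  rw [weightSpace, eigenspace_eq_span_of_diagonal (vermaBasis n) (vermaTensor_h m)] at hx'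
  -- Membership goes inside the statement so that the span induction can evaluate φ at each stage.
  suffices hs : ∃ hx : x ∈ weightSpace (vermaTensor m) μ, extendWeight m φ x = φ ⟨x, hx⟩ from
    hs.2
  clear hx
  induction hx' using Submodule.span_induction with
  | mem x hx =>
    obtain ⟨J, hJ, rfl⟩ := hx
    have hJ' := (vermaBasis_mem_weightSpace m J μ).2 hJ
    exact ⟨hJ', by rw [extendWeight, Module.Basis.constr_basis, dif_pos hJ']⟩
  | zero => exact ⟨zero_mem _, (map_zero _).trans (map_zero φ).symm⟩
  | add x y _ _ hx hy =>
    obtain ⟨hx, hx'⟩ := hx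
    obtain ⟨hy, hy'⟩ := hy
    exact ⟨add_mem hx hy, by rw [map_add, hx', hy', ← map_add]; rfl⟩
  | smul c x _ hx =>
    obtain ⟨hx, hx'⟩ := hx
    exact ⟨Submodule.smul_mem _ c hx, by rw [map_smul, hx', ← map_smul]; rfl⟩

theorem extendWeight_h {μ : ℂ} (φ : Module.Dual ℂ (weightSpace (vermaTensor m) μ))
    (x : ⨂[ℂ] _i : Fin n, (ℕ →₀ ℂ)) :
    extendWeight m φ (vermaTensor m h x) = μ * extendWeight m φ x := by
  suffices hb : extendWeight m φ ∘ₗ vermaTensor m h = μ • extendWeight m φ from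
    LinearMap.congr_fun hb x
  refine (vermaBasis n).ext fun J => ?_
  rw [LinearMap.comp_apply, vermaTensor_h, map_smul, LinearMap.smul_apply]
  by_cases hJ : vermaBasis n J ∈ weightSpace (vermaTensor m) μ
  · rw [(vermaBasis_mem_weightSpace m J μ).1 hJ]
  · rw [extendWeight, Module.Basis.constr_basis, dif_neg hJ, smul_zero, smul_zero]

theorem extendWeight_e {μ : ℂ} {φ : Module.Dual ℂ (weightSpace (vermaTensor m) (μ + 2))}
    (hφ : dualLower (vermaTensor m) μ φ = 0) : extendWeight m φ ∘ₗ vermaTensor m e = 0 := by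
  refine (vermaBasis n).ext fun J => ?_
  rw [LinearMap.comp_apply, LinearMap.zero_apply]
  have hJ := (vermaBasis_mem_weightSpace m J _).2 rfl
  by_cases hμ : (size m : ℂ) - 2 * ((∑ i, J i : ℕ) : ℂ) = μ
  · rw [hμ] at hJ
    exact (extendWeight_of_mem m φ (raise (vermaTensor m) μ ⟨_, hJ⟩)).trans
      (LinearMap.congr_fun hφ ⟨_, hJ⟩)
  -- Here e maps the monomial to a weight other than μ + 2, where the extended functional is zero.
  · have he := e_mem_weightSpace _ _ _ hJ
    have hh := extendWeight_h m φ (vermaTensor m e (vermaBasis n J))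
    rw [Module.End.mem_eigenspace_iff.1 he, map_smul, smul_eq_mul, mul_eq_mul_right_iff] at hh
    exact hh.resolve_left fun h' => hμ (add_right_cancel h')

theorem pairing_eq_zero_of_weight_ne {μ : ℂ} {u : ⨂[ℂ] i : Fin n, (Fin (m i + 1) →₀ ℂ)}
    (hu : u ∈ weightSpace (irrTensor m) μ) {J : Fin n → ℕ}
    (hJ : vermaBasis n J ∉ weightSpace (vermaTensor m) μ) : pairing m u (vermaBasis n J) = 0 := by
  have hh := pairing_h m u (vermaBasis n J)
  rw [Module.End.mem_eigenspace_iff.1 hu, vermaTensor_h, map_smul, map_smul,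
    LinearMap.smul_apply, smul_eq_mul, smul_eq_mul, mul_eq_mul_right_iff] at hh
  exact hh.resolve_left fun h' => hJ ((vermaBasis_mem_weightSpace m J _).2 h'.symm)

/-- The kernel of the contragredient action of `f` on `(M^{⊗ m}[μ + 2])^*` consists of the vectors
of `L^{⊗ m}[μ + 2]` killed by `f`. -/
def lowestEquivKer (μ : ℂ) :
    lowestVectors (irrTensor m) (μ + 2) ≃ₗ[ℂ] LinearMap.ker (dualLower (vermaTensor m) μ) :=
  LinearEquiv.ofBijective
    (((weightSpace (vermaTensor m) (μ + 2)).subtype.dualMap ∘ₗ pairing m ∘ₗ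
      (lowestVectors (irrTensor m) (μ + 2)).subtype).codRestrict
        (LinearMap.ker (dualLower (vermaTensor m) μ)) (by
          intro u
          refine LinearMap.mem_ker.2 (LinearMap.ext fun x => ?_)
          change pairing m u (vermaTensor m e x) = 0
          rw [← pairing_f, ((mem_lowestVectors _).1 u.2).2, map_zero, LinearMap.zero_apply])) <| by
    constructor
    · intro u v huv
      refine Subtype.ext (pairing_injective m ((vermaBasis n).ext fun J => ?_))
      by_cases hJ : vermaBasis n J ∈ weightSpace (vermaTensor m) (μ + 2)
      · exact LinearMap.congr_fun (congrArg Subtype.val huv) ⟨_, hJ⟩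
      · rw [pairing_eq_zero_of_weight_ne m u.2.1 hJ, pairing_eq_zero_of_weight_ne m v.2.1 hJ]
    · rintro ⟨φ, hφ⟩
      have hE := extendWeight_e m hφ
      obtain ⟨u, hu⟩ := exists_pairing_eq m hE
      refine ⟨⟨u, (mem_lowestVectors _).2 ⟨pairing_injective m ?_, pairing_injective m ?_⟩⟩,
        Subtype.ext (LinearMap.ext fun x => ?_)⟩
      · refine LinearMap.ext fun x => ?_
        rw [pairing_h, hu, extendWeight_h, map_smul, hu]
        rfl
      · refine LinearMap.ext fun x => ?_
        rw [pairing_f, hu, map_zero]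
        exact LinearMap.congr_fun hE x
      · change pairing m u x = φ x
        rw [hu, extendWeight_of_mem]

end kernel

/-! ### Rank-nullity for the dual map -/

section dualLower

variable {V : Type} [AddCommGroup V] [Module ℂ V] (ρ : Rep V) (μ : ℂ)

theorem rank_ker_dualLower (h₁ : Module.Finite ℂ (weightSpace ρ (μ + 2))) :
    Module.rank ℂ (LinearMap.ker (dualLower ρ μ)) =
      Module.finrank ℂ (LinearMap.ker (dualLower ρ μ)) :=
  (Module.finrank_eq_rank _ _).symm

theorem rank_coker_dualLower (h₀ : Module.Finite ℂ (weightSpace ρ μ))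
    (h₁ : Module.Finite ℂ (weightSpace ρ (μ + 2))) {c : ℕ}
    (hc : Module.finrank ℂ (weightSpace ρ μ) = Module.finrank ℂ (weightSpace ρ (μ + 2)) + c) :
    Module.rank ℂ (Module.Dual ℂ (weightSpace ρ μ) ⧸ LinearMap.range (dualLower ρ μ)) =
      ((Module.finrank ℂ (LinearMap.ker (dualLower ρ μ)) + c : ℕ) : Cardinal) := by
  have hrange := (LinearMap.range (dualLower ρ μ)).finrank_quotient_add_finrank
  have hker := (dualLower ρ μ).finrank_range_add_finrank_ker
  rw [Subspace.dual_finrank_eq] at hrange hker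
  rw [← Module.finrank_eq_rank]
  congr 1
  omega

end dualLower

/-! ### Dimensions of the kernel and cokernel -/

section dimensionCount

variable {n : ℕ} (m : Fin n → ℕ) (k : ℕ)

/-- Pascal's rule for multisets: those of size k on n letters either omit a given letter, giving the
binomial coefficient, or come from size k - 1 by adding it. -/
theorem finrank_weightSpace_eq_add (hn : 1 ≤ n) :
    Module.finrank ℂ (weightSpace (vermaTensor m) ((size m : ℂ) - 2 * (k : ℂ))) =
      Module.finrank ℂ (weightSpace (vermaTensor m) ((size m : ℂ) - 2 * (k : ℂ) + 2)) +
        (n + k - 2).choose k := by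
  rw [finrank_weightSpace_vermaTensor]
  obtain ⟨n, rfl⟩ : ∃ l, n = l + 1 := ⟨n - 1, by omega⟩
  rcases k with _ | k
  · suffices h0 : Module.finrank ℂ
        (weightSpace (vermaTensor m) ((size m : ℂ) - 2 * ((0 : ℕ) : ℂ) + 2)) = 0 by
      simp [h0]
    rw [weightSpace, finrank_eigenspace_of_diagonal (vermaBasis _) (vermaTensor_h m)]
    have : IsEmpty {J : Fin (n + 1) → ℕ // (size m : ℂ) - 2 * ((∑ i, J i : ℕ) : ℂ) =
        (size m : ℂ) - 2 * ((0 : ℕ) : ℂ) + 2} := by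
      -- Weight |m| + 2 would need exponents summing to -1.
      refine ⟨fun ⟨J, hJ⟩ => Nat.cast_add_one_ne_zero (R := ℂ) (∑ i, J i) ?_⟩
      push_cast at hJ ⊢
      linear_combination -hJ / 2
    exact Nat.card_of_isEmpty
  · have hμ : (size m : ℂ) - 2 * ((k + 1 : ℕ) : ℂ) + 2 = (size m : ℂ) - 2 * (k : ℂ) := by
      push_cast; ring
    rw [hμ, finrank_weightSpace_vermaTensor, Nat.multichoose_succ_succ, Nat.multichoose_eq n,
      add_comm]
    congr 2
    omega

theorem rank_ker_fMap :
    Module.rank ℂ (LinearMap.ker (fMap m k)) = Module.finrank ℂ (LinearMap.ker (fMap m k)) :=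
  rank_ker_dualLower _ _ (finite_weightSpace_vermaTensor m ((size m : ℂ) - 2 * (k : ℂ) + 2))

theorem rank_coker_fMap (hn : 1 ≤ n) :
    Module.rank ℂ (Module.Dual ℂ (weightSpace (vermaTensor m)
      ((size m : ℂ) - 2 * (k : ℂ))) ⧸ LinearMap.range (fMap m k)) =
      ((Module.finrank ℂ (LinearMap.ker (fMap m k)) + (n + k - 2).choose k : ℕ) : Cardinal) :=
  rank_coker_dualLower _ _ (finite_weightSpace_vermaTensor m _)
    (finite_weightSpace_vermaTensor m _) (finrank_weightSpace_eq_add m k hn)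

theorem finiteDimensional_irrTensor :
    FiniteDimensional ℂ (⨂[ℂ] i : Fin n, (Fin (m i + 1) →₀ ℂ)) :=
  Module.Finite.of_basis (irrBasis m)

theorem finrank_ker_fMap (hk : (size m : ℤ) - k + 1 < k) :
    Module.finrank ℂ (LinearMap.ker (fMap m k)) = w m ((size m : ℤ) - k + 1) := by
  have := finiteDimensional_irrTensor m
  obtain ⟨p, hp⟩ : ∃ p : ℕ, (size m : ℤ) - 2 * ((size m : ℤ) - k + 1) = p :=
    ⟨((size m : ℤ) - 2 * ((size m : ℤ) - k + 1)).toNat, by omega⟩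
  rw [w, hp, if_pos (Int.natCast_nonneg p), Int.toNat_natCast, multiplicity_irr]
  have hp' : -(p : ℂ) = (size m : ℂ) - 2 * (k : ℂ) + 2 := by
    have : (p : ℂ) = ((p : ℤ) : ℂ) := by simp
    rw [this, ← hp]
    push_cast
    ring
  rw [hp']
  exact (lowestEquivKer m _).finrank_eq.symm

theorem ker_fMap_eq_bot
    (hk : ¬ (0 ≤ (size m : ℤ) - k + 1 ∧ (size m : ℤ) - k + 1 < k)) :
    LinearMap.ker (fMap m k) = ⊥ := by
  have := finiteDimensional_irrTensor m
  have hbot : ∀ u ∈ lowestVectors (irrTensor m) ((size m : ℂ) - 2 * (k : ℂ) + 2), u = 0 := by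
    intro u hu
    by_contra hu0
    -- A nonzero u forces both excluded inequalities: weight -p gives |m| - k + 1 < k, and a
    -- monomial of that weight in L^{⊗m} gives k - 1 ≤ |m|.
    obtain ⟨p, hp⟩ := exists_nat_of_mem_lowestVectors _ hu hu0
    obtain ⟨J, hJ⟩ : ∃ J : ∀ i, Fin (m i + 1),
        (size m : ℂ) - 2 * ((∑ i, (J i).1 : ℕ) : ℂ) = (size m : ℂ) - 2 * (k : ℂ) + 2 := by
      by_contra hJ
      have hs := hu.1
      rw [weightSpace, eigenspace_eq_span_of_diagonal (irrBasis m) (irrTensor_h m)] at hs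
      have hempty : {J : ∀ i, Fin (m i + 1) | (size m : ℂ) - 2 * ((∑ i, (J i).1 : ℕ) : ℂ) =
          (size m : ℂ) - 2 * (k : ℂ) + 2} = ∅ :=
        Set.eq_empty_of_forall_notMem fun J hJ' => hJ ⟨J, hJ'⟩
      rw [hempty, Set.image_empty, Submodule.span_empty] at hs
      exact hu0 ((Submodule.mem_bot ℂ).1 hs)
    have hle : ∑ i, (J i).1 ≤ size m :=
      Finset.sum_le_sum fun i _ => Nat.lt_succ_iff.1 (J i).2
    have h1 : ((∑ i, (J i).1 : ℕ) : ℂ) + 1 = k := by linear_combination -hJ / 2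
    have h2 : (size m : ℂ) + 2 + p = 2 * k := by linear_combination hp
    have h1' : ∑ i, (J i).1 + 1 = k := by exact_mod_cast h1
    have h2' : size m + 2 + p = 2 * k := by exact_mod_cast h2
    omega
  rw [Submodule.eq_bot_iff]
  intro φ hφ
  have h0 : (lowestEquivKer m _).symm ⟨φ, hφ⟩ = 0 :=
    Subtype.ext (hbot _ ((lowestEquivKer m _).symm ⟨φ, hφ⟩).2)
  exact congrArg Subtype.val ((LinearEquiv.map_eq_zero_iff _).1 h0)

end dimensionCount

end

end SlTwo

/-! ### The theorem -/

theorem theorem3p1 (n : ℕ) (hn : 1 ≤ n) (m : Fin n → ℕ) (k : ℕ) :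
    ((0 ≤ (SlTwo.size m : ℤ) - k + 1 ∧ (SlTwo.size m : ℤ) - k + 1 < k) →
      Module.rank ℂ (LinearMap.ker (SlTwo.fMap m k)) =
          (SlTwo.w m ((SlTwo.size m : ℤ) - k + 1) : Cardinal) ∧
        Module.rank ℂ (Module.Dual ℂ (SlTwo.weightSpace (SlTwo.vermaTensor m)
            ((SlTwo.size m : ℂ) - 2 * (k : ℂ))) ⧸ LinearMap.range (SlTwo.fMap m k)) =
          ((SlTwo.w m ((SlTwo.size m : ℤ) - k + 1) + (n + k - 2).choose k : ℕ) : Cardinal)) ∧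
    (¬ (0 ≤ (SlTwo.size m : ℤ) - k + 1 ∧ (SlTwo.size m : ℤ) - k + 1 < k) →
      LinearMap.ker (SlTwo.fMap m k) = ⊥ ∧
        Module.rank ℂ (Module.Dual ℂ (SlTwo.weightSpace (SlTwo.vermaTensor m)
            ((SlTwo.size m : ℂ) - 2 * (k : ℂ))) ⧸ LinearMap.range (SlTwo.fMap m k)) =
          (((n + k - 2).choose k : ℕ) : Cardinal)) := by
  refine ⟨fun hk => ?_, fun hk => ?_⟩
  · rw [SlTwo.rank_ker_fMap, SlTwo.rank_coker_fMap m k hn, SlTwo.finrank_ker_fMap m k hk.2]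
    exact ⟨rfl, rfl⟩
  · have hbot := SlTwo.ker_fMap_eq_bot m k hk
    refine ⟨hbot, ?_⟩
    rw [SlTwo.rank_coker_fMap m k hn, hbot, finrank_bot, zero_add]
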